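/- Let $a\ge 0$ be an integer and let $$\mathcal U_a(q):=\sum_{0<k_1<k_2<\cdots<k_a}\frac{q^{k_1+k_2+\cdots+k_a}}{(1-q^{k_1})^2(1-q^{k_2})^2\cdots(1-q^{k_a})^2}\in\mathbb Q[[q]]$$ (so $\mathcal U_0(q)=1$). With $\sigma_\nu(n)=\sum_{d\mid n}d^\nu$, put $$E_2(q):=1-24\sum_{n\ge1}\sigma_1(n)q^n,\qquad E_4(q):=1+240\sum_{n\ge1}\sigma_3(n)q^n,\qquad E_6(q):=1-504\sum_{n\ge1}\sigma_5(n)q^n .$$ Define rational numbers $c(\alpha,\beta,\gamma)$ for integers $\alpha,\beta,\gamma$ by $c(0,0,0):=1$, by $c(\alpha,\beta,\gamma):=0$ if any of the arguments is negative, and, for all other triples, by the recursion $$c(\alpha,\beta,\gamma):=-\tfrac13(2\alpha+8\beta+12\gamma+1)\,c(\alpha-1,\beta,\gamma)+\tfrac23(\alpha+1)\,c(\alpha+1,\beta-1,\gamma)+\tfrac83(\beta+1)\,c(\alpha,\beta+1,\gamma-1)+4(\gamma+1)\,c(\alpha,\beta-2,\gamma+1).$$ For $0\le t\le a$ let $$w_t(a):=\frac{\binom{2a}{a}}{16^a(2a+1)}\sum_{0\le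 \ell_1<\cdots<\ell_t<a}\ \prod_{j=1}^t\frac1{(2\ell_j+1)^2},$$ where for $t=0$ the sum equals $1$. Then, as formal power series in $q$, $$\mathcal U_a(q)=\sum_{t=0}^a w_t(a)\sum_{\substack{\alpha,\beta,\gamma\ge0\\ \alpha+2\beta+3\gamma=t}}c(\alpha,\beta,\gamma)\,E_2(q)^\alpha E_4(q)^\beta E_6(q)^\gamma .$$ -/

import Mathlib

namespace MacMahon

open PowerSeries
open scoped PowerSeries.WithPiTopology

noncomputable section

/-- The summand of `U_a(q)` attached to a finite set `s = {k₁ < ⋯ < k_a}` of positive integers,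
as a formal power series in `q = X`: the product over `k ∈ s` of `q ^ k / (1 - q ^ k) ^ 2`. -/
def term (s : Finset ℕ+) : ℚ⟦X⟧ :=
  ∏ k ∈ s, X ^ (k : ℕ) * ((1 - X ^ (k : ℕ)) ^ 2)⁻¹

/-- MacMahon's series `U_a(q)`: the sum of
`q ^ (k₁ + ⋯ + k_a) / ((1 - q ^ k₁) ^ 2 ⋯ (1 - q ^ k_a) ^ 2)` over all `0 < k₁ < ⋯ < k_a`
(equivalently, over all `a`-element sets of positive integers), for the topology of
coefficientwise convergence on `ℚ⟦X⟧`. -/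
def U (a : ℕ) : ℚ⟦X⟧ :=
  ∑' s : {s : Finset ℕ+ // s.card = a}, term s.1

/-- The sum defining `U a` converges: only finitely many summands contribute to each coefficient. -/
theorem hasSum_U (a : ℕ) :
    HasSum (fun s : {s : Finset ℕ+ // s.card = a} => term s.1) (U a) := by
  refine Summable.hasSum ?_
  rw [PowerSeries.WithPiTopology.summable_iff_summable_coeff]
  intro d
  refine summable_of_hasFiniteSupport (Set.Finite.subset
    (s := {s | s.1 ∈ (Finset.Icc (1 : ℕ+) (d + 1).toPNat').powerset}) ?_ ?_)
  · exact (Finset.finite_toSet (Finset.Icc (1 : ℕ+) (d + 1).toPNat').powerset).preimage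
      Subtype.val_injective.injOn
  · intro s hs
    rw [Set.mem_ofPred_eq, Finset.mem_powerset]
    intro k hk
    by_contra hcon
    refine hs ?_
    have hk' : d < (k : ℕ) := by
      rw [Finset.mem_Icc, not_and] at hcon
      have h1 := hcon (one_le)
      rw [← PNat.coe_le_coe, not_le, Nat.toPNat'_coe, if_pos (Nat.succ_pos d)] at h1
      omega
    have hdvd : (X : ℚ⟦X⟧) ^ (k : ℕ) ∣ term s.1 :=
      (Dvd.intro _ rfl).trans (Finset.dvd_prod_of_mem _ hk)
    exact (X_pow_dvd_iff.mp hdvd) d hk'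

/-- `E₂(q) = 1 - 24 ∑_{n ≥ 1} σ₁(n) q ^ n` (recall `σ k 0 = 0`). -/
def E₂ : ℚ⟦X⟧ := 1 - 24 * PowerSeries.mk fun n => (ArithmeticFunction.sigma 1 n : ℚ)

/-- `E₄(q) = 1 + 240 ∑_{n ≥ 1} σ₃(n) q ^ n`. -/
def E₄ : ℚ⟦X⟧ := 1 + 240 * PowerSeries.mk fun n => (ArithmeticFunction.sigma 3 n : ℚ)

/-- `E₆(q) = 1 - 504 ∑_{n ≥ 1} σ₅(n) q ^ n`. -/
def E₆ : ℚ⟦X⟧ := 1 - 504 * PowerSeries.mk fun n => (ArithmeticFunction.sigma 5 n : ℚ)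

/-- The numbers `c(α, β, γ)`: zero if some argument is negative, `c(0, 0, 0) = 1`, and the
four-term recursion at all other triples of non-negative integers. -/
def c (α β γ : ℤ) : ℚ :=
  if α < 0 ∨ β < 0 ∨ γ < 0 then 0
  else if α = 0 ∧ β = 0 ∧ γ = 0 then 1
  else
    -(1 / 3) * (2 * α + 8 * β + 12 * γ + 1) * c (α - 1) β γ
      + 2 / 3 * (α + 1) * c (α + 1) (β - 1) γ
      + 8 / 3 * (β + 1) * c α (β + 1) (γ - 1)
      + 4 * (γ + 1) * c α (β - 2) (γ + 1)
termination_by (α + 2 * β + 3 * γ).toNat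
decreasing_by all_goals omega

/-- `w_t(a)`: the quotient of `binom(2a, a)` by `16 ^ a (2a + 1)`, times the sum over
`0 ≤ ℓ₁ < ⋯ < ℓ_t < a` of the product of the `1 / (2 ℓ_j + 1) ^ 2`. -/
def w (t a : ℕ) : ℚ :=
  ((2 * a).choose a : ℚ) / (16 ^ a * (2 * a + 1)) *
    ∑ s ∈ (Finset.range a).powersetCard t, ∏ l ∈ s, 1 / (2 * (l : ℚ) + 1) ^ 2

/-- All triples `(α, β, γ)` of non-negative integers with `α + 2β + 3γ = t`. -/
def triples (t : ℕ) : Finset (ℕ × ℕ × ℕ) :=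
  (Finset.range (t + 1) ×ˢ Finset.range (t + 1) ×ˢ Finset.range (t + 1)).filter
    fun p => p.1 + 2 * p.2.1 + 3 * p.2.2 = t

theorem mem_triples (t α β γ : ℕ) : (α, β, γ) ∈ triples t ↔ α + 2 * β + 3 * γ = t := by
  simp only [triples, Finset.mem_filter, Finset.mem_product, Finset.mem_range]
  omega

end

end MacMahon

/-! Put x = 2 - z - 1/z. The generating function ∑ U_a x^a is ∏ (1 + x q^k / (1 - q^k)^2). By the
Jacobi triple product, (q; q)_∞^3 times it is a theta series whose x^a coefficient is ∑ (-1)^n pc(a,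
n) q^(n(n+1)/2). As n(n+1)/2 · pc(a, n) is a combination of pc(a, n) and pc(a+1, n), a heat equation
holds (`D_U`), which for D = q d/dq and L = -(8 D + E₂) reads 8 (2a+3)(a+1) U_{a+1} = (2a+1)^2 U_a +
L U_a (`U_succ`).

Unrolled, this is U_a = ∑ w_t(a) L^t 1, since w obeys the matching scalar recursion (`w_succ_succ`).
That L^t 1 is `quasi t` follows from Ramanujan's formulas for D E₂, D E₄, D E₆: the recursion for c
is the transpose of L on monomials (`L_mon`, `quasi_succ`). Those formulas come from the heat
equation at a = 1, 2, 3, with U_1, …, U_4 written in divisor sums, and from E₈ = E₄², the only input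
from modular forms. Infinite products are handled by truncation modulo q^(N+1). -/

namespace MacMahon

open PowerSeries
open scoped PowerSeries.WithPiTopology

noncomputable section


/-! ### The identity E₈ = E₄² -/

/-- `E₈(q) = 1 + 480 ∑_{n ≥ 1} σ₇(n) q ^ n`. -/
def E₈ : ℚ⟦X⟧ := 1 + 480 * PowerSeries.mk fun n => (ArithmeticFunction.sigma 7 n : ℚ)

/-- An even-weight Eisenstein series has rational `q`-expansion. -/
theorem qExpansion_E_eq_map {k : ℕ} (hk : 3 ≤ k) (hk2 : Even k) (r : ℚ)
    (hr : -(2 * k / bernoulli k) = r) :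
    UpperHalfPlane.qExpansion 1 (ModularForm.E hk) = PowerSeries.map (algebraMap ℚ ℂ)
      (1 + C r * PowerSeries.mk fun n => (ArithmeticFunction.sigma (k - 1) n : ℚ)) := by
  ext n
  rw [EisensteinSeries.E_qExpansion_coeff hk hk2, ← hr]
  rcases eq_or_ne n 0 with rfl | hn
  · simp [-coeff_zero_eq_constantCoeff]
  · simp [hn, coeff_one]

-- The difference vanishes in degrees 0 and 1, which exceeds the level-one Sturm bound 8/12.
open UpperHalfPlane ModularForm ModularFormClass MatrixGroups EisensteinSeries in
theorem modularForm_E_eight_eq_sq (h8 : 3 ≤ 8) :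
    ModularForm.mcast (by decide) (ModularForm.E₄.pow 2) = ModularForm.E h8 := by
  rw [← sub_eq_zero]
  apply sturm_bound_levelOne_nat (k := 8)
  refine lt_of_lt_of_le (b := ((2 : ℕ) : ℕ∞)) (by norm_num) (PowerSeries.nat_le_order _ _ ?_)
  intro i hi
  have h4 : (qExpansion 1 ModularForm.E₄).coeff 0 = 1 := E_qExpansion_coeff_zero _ ⟨2, rfl⟩
  have h8' : (qExpansion 1 (ModularForm.E h8)).coeff 0 = 1 := E_qExpansion_coeff_zero _ ⟨4, rfl⟩
  have h81 : (qExpansion 1 (ModularForm.E h8)).coeff 1 = 480 := by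
    norm_num [E_qExpansion_coeff _ (show Even 8 from ⟨4, rfl⟩),
      show bernoulli 8 = -1 / 30 by decide +kernel]
  have hq : qExpansion 1 (ModularForm.mcast (by decide) (ModularForm.E₄.pow 2) - ModularForm.E h8 :
      ModularForm 𝒮ℒ 8) = qExpansion 1 ModularForm.E₄ * qExpansion 1 ModularForm.E₄ - qExpansion 1 (ModularForm.E h8) := by
    rw [← sq]
    simp only [FunLike.coe_sub, coe_mcast,
      ModularForm.qExpansion_sub one_pos one_mem_strictPeriods_SL,
      ModularForm.qExpansion_pow one_pos one_mem_strictPeriods_SL]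
  erw [hq]
  interval_cases i
  · simp [coeff_mul, h4, h8', -PowerSeries.coeff_zero_eq_constantCoeff]
  · norm_num [coeff_mul, Finset.Nat.antidiagonal_succ, h4, h81, E₄_qExpansion_coeff_one,
      -PowerSeries.coeff_zero_eq_constantCoeff]

open UpperHalfPlane ModularForm ModularFormClass MatrixGroups EisensteinSeries in
theorem E₈_eq_sq : E₈ = MacMahon.E₄ ^ 2 := by
  have h := congrArg (fun f : ModularForm 𝒮ℒ 8 => qExpansion 1 f)
    (modularForm_E_eight_eq_sq (by norm_num))
  have h4 := qExpansion_E_eq_map (k := 4) (by norm_num) ⟨2, rfl⟩ 240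
    (by rw [show bernoulli 4 = -1 / 30 by decide +kernel]; norm_num)
  have h8 := qExpansion_E_eq_map (k := 8) (by norm_num) ⟨4, rfl⟩ 480
    (by rw [show bernoulli 8 = -1 / 30 by decide +kernel]; norm_num)
  simp only [coe_mcast, ModularForm.qExpansion_pow one_pos one_mem_strictPeriods_SL] at h
  erw [h4, h8, ← map_pow] at h
  exact (PowerSeries.map_injective _ (algebraMap ℚ ℂ).injective h).symm


/-! ### Elementary symmetric sums and Newton's identities -/

/-- Elementary symmetric sums of `f 0, …, f (N - 1)`. -/
def esum {R : Type*} [CommRing R] (f : ℕ → R) (N a : ℕ) : R :=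
  ∑ s ∈ (Finset.range N).powersetCard a, ∏ k ∈ s, f k

section esum
variable {R : Type*} [CommRing R] (f : ℕ → R)

theorem esum_zero_right (N : ℕ) : esum f N 0 = 1 := by simp [esum]

theorem esum_eq_zero {N a : ℕ} (h : N < a) : esum f N a = 0 := by
  rw [esum, Finset.powersetCard_eq_empty.mpr (by simpa using h), Finset.sum_empty]

theorem esum_succ_succ (N a : ℕ) :
    esum f (N + 1) (a + 1) = esum f N (a + 1) + f N * esum f N a := by
  unfold esum
  rw [Finset.range_add_one, Finset.powersetCard_succ_insert (by simp), Finset.sum_union,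
    Finset.sum_image, Finset.mul_sum]
  · congr 1
    refine Finset.sum_congr rfl fun s hs => Finset.prod_insert fun h => ?_
    simpa using (Finset.mem_powersetCard.mp hs).1 h
  · intro s hs t ht hst
    have hs' : N ∉ s := fun h => by simpa using (Finset.mem_powersetCard.mp hs).1 h
    have ht' : N ∉ t := fun h => by simpa using (Finset.mem_powersetCard.mp ht).1 h
    rw [← Finset.erase_insert hs', ← Finset.erase_insert ht']
    exact congrArg (fun u => Finset.erase u N) hst
  · rw [Finset.disjoint_left]
    intro s hs hs'
    obtain ⟨t, -, rfl⟩ := Finset.mem_image.mp hs'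
    simpa using (Finset.mem_powersetCard.mp hs).1 (Finset.mem_insert_self N t)

theorem esum_one (N : ℕ) : esum f N 1 = ∑ k ∈ Finset.range N, f k := by
  induction N with
  | zero => simp [esum_eq_zero]
  | succ N ih => rw [esum_succ_succ, ih, Finset.sum_range_succ, esum_zero_right, mul_one]

/-- This and the next two are Newton's identities; degree 4 is the last one needed, for U_4 in the
formula for D E₆. -/
theorem two_mul_esum_two (N : ℕ) :
    2 * esum f N 2 = (∑ k ∈ Finset.range N, f k) ^ 2 - ∑ k ∈ Finset.range N, f k ^ 2 := by
  induction N with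
  | zero => simp [esum_eq_zero]
  | succ N ih =>
    rw [esum_succ_succ, esum_one, Finset.sum_range_succ, Finset.sum_range_succ]
    linear_combination ih

theorem six_mul_esum_three (N : ℕ) :
    6 * esum f N 3 = (∑ k ∈ Finset.range N, f k) ^ 3
      - 3 * (∑ k ∈ Finset.range N, f k) * (∑ k ∈ Finset.range N, f k ^ 2)
      + 2 * ∑ k ∈ Finset.range N, f k ^ 3 := by
  induction N with
  | zero => simp [esum_eq_zero]
  | succ N ih =>
    simp only [esum_succ_succ, Finset.sum_range_succ]
    linear_combination ih + 3 * f N * two_mul_esum_two f N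

theorem twentyFour_mul_esum_four (N : ℕ) :
    24 * esum f N 4 = (∑ k ∈ Finset.range N, f k) ^ 4
      - 6 * (∑ k ∈ Finset.range N, f k) ^ 2 * (∑ k ∈ Finset.range N, f k ^ 2)
      + 3 * (∑ k ∈ Finset.range N, f k ^ 2) ^ 2
      + 8 * (∑ k ∈ Finset.range N, f k) * (∑ k ∈ Finset.range N, f k ^ 3)
      - 6 * ∑ k ∈ Finset.range N, f k ^ 4 := by
  induction N with
  | zero => simp [esum_eq_zero]
  | succ N ih =>
    simp only [esum_succ_succ, Finset.sum_range_succ]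
    linear_combination ih + 4 * f N * six_mul_esum_three f N

end esum

/-! ### q-binomial coefficients -/

/-- `∏_{k = 1}^N (1 - q ^ k)`. -/
def qP (N : ℕ) : ℚ⟦X⟧ := ∏ k ∈ Finset.range N, (1 - X ^ (k + 1))

theorem qP_succ (N : ℕ) : qP (N + 1) = qP N * (1 - X ^ (N + 1)) := Finset.prod_range_succ _ _

theorem constantCoeff_qP (N : ℕ) : constantCoeff (qP N) = 1 := by
  simp [qP]

theorem qP_mul_inv (N : ℕ) : qP N * (qP N)⁻¹ = 1 :=
  PowerSeries.mul_inv_cancel _ (by simp [constantCoeff_qP])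

theorem X_pow_dvd_qP_sub (m i : ℕ) : (X : ℚ⟦X⟧) ^ (m + 1) ∣ qP (m + i) - qP m := by
  induction i with
  | zero => simp
  | succ i ih =>
    rw [← add_assoc, qP_succ]
    have h : (X : ℚ⟦X⟧) ^ (m + 1) ∣ qP (m + i) * X ^ (m + i + 1) :=
      Dvd.dvd.mul_left (pow_dvd_pow _ (by omega)) _
    convert dvd_sub ih h using 1
    ring

/-- `q ^ k / (1 - q ^ k) ^ 2` with `k` shifted by one. -/
def xq (k : ℕ) : ℚ⟦X⟧ := X ^ (k + 1) * ((1 - X ^ (k + 1)) ^ 2)⁻¹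

theorem one_sub_sq_mul_xq (k : ℕ) : (1 - X ^ (k + 1)) ^ 2 * xq k = X ^ (k + 1) := by
  rw [xq, mul_left_comm, PowerSeries.mul_inv_cancel _ (by simp), mul_one]

/-- `1 / (q; q)_{m - 1}`, zero for `m = 0`. -/
def invqP : ℕ → ℚ⟦X⟧
  | 0 => 0
  | m + 1 => (qP m)⁻¹

/-- The value 0 of `invqP` at 0 keeps this valid at m = 0, where the left factor vanishes. -/
theorem one_sub_mul_invqP (m : ℕ) : (1 - X ^ m) * invqP (m + 1) = invqP m := by
  cases m with
  | zero => simp [invqP]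
  | succ m =>
    simp only [invqP]
    have h1 := qP_mul_inv m
    have h2 := qP_mul_inv (m + 1)
    rw [qP_succ] at *
    linear_combination (qP m)⁻¹ * h2 - (1 - X ^ (m + 1)) * (qP m * (1 - X ^ (m + 1)))⁻¹ * h1

/-- The `q`-binomial coefficient `[2N + 1, N - n]`, zero for `n > N`. -/
def qR (N n : ℕ) : ℚ⟦X⟧ := qP (2 * N + 1) * invqP (N + 1 - n) * invqP (N + 2 + n)

theorem qR_eq_zero {N n : ℕ} (h : N < n) : qR N n = 0 := by
  rw [qR, show N + 1 - n = 0 by omega]; simp [invqP]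

/-- The q-Pascal rule used twice, as the top index grows by 2. With all reciprocals expressed by
those of largest index it is a polynomial identity. -/
theorem qR_succ_succ (N n : ℕ) :
    qR (N + 1) (n + 1) = (1 + X ^ (2 * N + 2)) * qR N (n + 1) + X ^ (N - n) * qR N n
      + X ^ (N + n + 3) * qR N (n + 2) := by
  rcases lt_or_ge N n with h | h
  · simp [qR_eq_zero, h, Nat.lt_succ_of_lt h, show N < n + 2 by omega]
  obtain ⟨m, rfl⟩ := Nat.exists_eq_add_of_le h
  simp only [qR]
  rw [show n + m + 1 + 1 - (n + 1) = m + 1 by omega, show n + m + 1 - (n + 1) = m by omega,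
    show n + m + 1 - n = m + 1 by omega, show n + m + 1 - (n + 2) = m - 1 by omega,
    show n + m - n = m by omega,
    show n + m + 1 + 2 + (n + 1) = 2 * n + m + 3 + 1 by ring,
    show n + m + 2 + (n + 1) = 2 * n + m + 2 + 1 by ring,
    show n + m + 2 + n = 2 * n + m + 1 + 1 by ring,
    show n + m + 2 + (n + 2) = 2 * n + m + 3 + 1 by ring,
    show 2 * (n + m + 1) + 1 = 2 * (n + m) + 1 + 1 + 1 by ring, qP_succ, qP_succ,
    ← one_sub_mul_invqP (2 * n + m + 1 + 1), ← one_sub_mul_invqP (2 * n + m + 2 + 1)]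
  cases m with
  | zero => simp only [invqP, Nat.zero_sub, mul_zero, zero_mul, add_zero]; ring
  | succ m =>
    rw [Nat.add_sub_cancel, ← one_sub_mul_invqP m, ← one_sub_mul_invqP (m + 1)]
    ring

/-- The case n = -1 of the previous rule: the symmetry [2N+1, N+1] = [2N+1, N] replaces index -1 by
0. -/
theorem qR_succ_zero (N : ℕ) :
    qR (N + 1) 0 = (1 + X ^ (2 * N + 2)) * qR N 0 + X ^ (N + 1) * qR N 0
      + X ^ (N + 2) * qR N 1 := by
  simp only [qR]
  rw [show N + 1 + 1 - 0 = N + 1 + 1 by omega, show N + 1 - 0 = N + 1 by omega,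
    show N + 1 - 1 = N by omega,
    show N + 1 + 2 + 0 = N + 2 + 1 by ring, show N + 2 + 0 = N + 1 + 1 by ring,
    show 2 * (N + 1) + 1 = 2 * N + 1 + 1 + 1 by ring, qP_succ, qP_succ,
    ← one_sub_mul_invqP N, ← one_sub_mul_invqP (N + 1), ← one_sub_mul_invqP (N + 2)]
  ring

/-! ### Coefficients of z^(-y) + ⋯ + z^y in powers of x -/

/-- The even factor `∏_{i < a} (i (i + 1) - y (y + 1)) / ((2 i + 2) (2 i + 3))`. -/
def pf : ℕ → ℚ → ℚ
  | 0, _ => 1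
  | a + 1, y => pf a y * ((a * (a + 1) - y * (y + 1)) / ((2 * a + 2) * (2 * a + 3)))

theorem pf_neg_one_sub (a : ℕ) (y : ℚ) : pf a (-1 - y) = pf a y := by
  induction a with
  | zero => rfl
  | succ a ih => rw [pf, pf, ih]; ring

/-- Each factor i(i+1) - y(y+1) is -(y-i)(y+i+1), so the numerator is, up to sign, a run of
consecutive factors, and shifting y changes only its ends. -/
theorem pf_succ_add_one (a : ℕ) (y : ℚ) :
    pf (a + 1) (y + 1) * ((2 * a + 2) * (2 * a + 3))
      = - ((y + a + 1) * (y + a + 2) * pf a y) := by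
  induction a with
  | zero => simp only [pf]; push_cast; ring
  | succ a ih =>
    rw [pf.eq_def (a + 1 + 1), pf.eq_def (a + 1) y]
    push_cast at *
    have h1 : (2 * (a : ℚ) + 2) * (2 * a + 3) ≠ 0 := by positivity
    have h2 : (2 * ((a : ℚ) + 1) + 2) * (2 * (a + 1) + 3) ≠ 0 := by positivity
    field_simp
    linear_combination ((y - a) * (y + a + 3)) * (-1) * ih

theorem pf_succ_sub_one (a : ℕ) (y : ℚ) :
    pf (a + 1) (y - 1) * ((2 * a + 2) * (2 * a + 3))
      = - ((y - a) * (y - a - 1) * pf a y) := by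
  have h := pf_succ_add_one a (-1 - y)
  rw [show -1 - y + 1 = -1 - (y - 1) by ring, pf_neg_one_sub, pf_neg_one_sub] at h
  linear_combination h

/-- The coefficient of `x ^ a` in `z ^ (-y) + ⋯ + z ^ y`, where `x = 2 - z - 1 / z`. -/
def pc (a : ℕ) (y : ℚ) : ℚ := (2 * y + 1) * pf a y

/-- Multiplying z^(-y) + ⋯ + z^y by z + 1/z = 2 - x adds its two neighbours; this is the x^(a+1)
coefficient. -/
theorem pc_three_term (a : ℕ) (y : ℚ) :
    pc (a + 1) (y + 1) + pc (a + 1) (y - 1) = 2 * pc (a + 1) y - pc a y := by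
  have h1 := pf_succ_add_one a y
  have h2 := pf_succ_sub_one a y
  have h0 : (2 * (a : ℚ) + 2) * (2 * a + 3) ≠ 0 := by positivity
  have h3 : pf (a + 1) y * ((2 * a + 2) * (2 * a + 3)) = pf a y * (a * (a + 1) - y * (y + 1)) := by
    rw [pf]; field_simp
  refine mul_right_cancel₀ h0 ?_
  simp only [pc]
  linear_combination (2 * (y + 1) + 1) * h1 + (2 * (y - 1) + 1) * h2 - 2 * (2 * y + 1) * h3

theorem pc_zero_three_term (y : ℚ) : pc 0 (y + 1) + pc 0 (y - 1) = 2 * pc 0 y := by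
  simp only [pc, pf]; ring

theorem pc_succ_zero (a : ℕ) : pc (a + 1) 0 = 0 := by
  suffices h : pf (a + 1) 0 = 0 by rw [pc, h, mul_zero]
  induction a with
  | zero => simp [pf]
  | succ a ih => rw [pf, ih, zero_mul]

theorem pc_neg_one (a : ℕ) : pc a (-1) = - pc a 0 := by
  have := pf_neg_one_sub a 0
  simp only [pc]
  rw [← this]; norm_num

/-- The source of the heat equation: y(y+1)/2 will be the exponent of q, and the recursion for `pf`
is solved for it. -/
theorem mul_pc (a : ℕ) (y : ℚ) :
    y * (y + 1) / 2 * pc a y = a * (a + 1) / 2 * pc a y - (2 * a + 3) * (a + 1) * pc (a + 1) y := by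
  simp only [pc, pf]
  field_simp
  ring

/-! ### The finite triple product -/

/-- Summation by parts for sequences extended oddly about `-1 / 2`. -/
theorem sum_reflect {R : Type*} [CommRing R] (r p : ℕ → R) (pm : ℕ → R) (h0 : pm 0 = - p 0)
    (h1 : ∀ n, pm (n + 1) = p n) (N : ℕ) (h : r (N + 1) = 0) (h' : r (N + 2) = 0) :
    (r 1 - r 0) * p 0 + ∑ n ∈ Finset.range (N + 1), (r n + r (n + 2)) * p (n + 1)
      = ∑ n ∈ Finset.range (N + 1), r n * (p (n + 1) + pm n) := by
  have e1 : ∑ n ∈ Finset.range (N + 1), r (n + 2) * p (n + 1) + r 1 * p 0 =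
      ∑ n ∈ Finset.range (N + 2), r (n + 1) * p n := by
    rw [Finset.sum_range_succ' _ (N + 1)]
  have e2 : ∑ n ∈ Finset.range (N + 1), r n * pm n =
      ∑ n ∈ Finset.range N, r (n + 1) * p n - r 0 * p 0 := by
    rw [Finset.sum_range_succ', h0]; simp only [h1]; ring
  rw [Finset.sum_range_succ _ (N + 1), Finset.sum_range_succ (fun n => r (n + 1) * p n) N, h,
    show r (N + 1 + 1) = 0 from h'] at e1
  simp only [add_mul, mul_add, Finset.sum_add_distrib]
  linear_combination e1 - e2

/-- The signed coefficients `(-1) ^ n q ^ (n (n + 1) / 2) [2N + 1, N - n]`. -/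
def rq (N n : ℕ) : ℚ⟦X⟧ := (-1) ^ n * X ^ (n * (n + 1) / 2) * qR N n

theorem triangle_succ (n : ℕ) : (n + 1) * (n + 1 + 1) / 2 = n * (n + 1) / 2 + (n + 1) := by
  rw [show (n + 1) * (n + 1 + 1) = n * (n + 1) + (n + 1) * 2 by ring,
    Nat.add_mul_div_right _ _ two_pos]

theorem rq_succ_succ (N n : ℕ) :
    rq (N + 1) (n + 1) = (1 + X ^ (2 * N + 2)) * rq N (n + 1)
      - X ^ (N + 1) * (rq N n + rq N (n + 2)) := by
  rw [rq, qR_succ_succ, rq, rq, rq, show n + 2 = n + 1 + 1 by rfl, triangle_succ (n + 1),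
    triangle_succ n]
  rcases lt_or_ge N n with h | h
  · simp [qR_eq_zero, h, Nat.lt_succ_of_lt h, show N < n + 1 + 1 by omega]
  obtain ⟨m, rfl⟩ := Nat.exists_eq_add_of_le h
  rw [Nat.add_sub_cancel_left]
  ring

theorem rq_succ_zero (N : ℕ) :
    rq (N + 1) 0 = (1 + X ^ (2 * N + 2)) * rq N 0 - X ^ (N + 1) * (rq N 1 - rq N 0) := by
  simp only [rq, qR_succ_zero]
  norm_num
  ring

theorem rq_eq_zero {N n : ℕ} (h : N < n) : rq N n = 0 := by rw [rq, qR_eq_zero h, mul_zero]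

/-- Models multiplication by 1 + q^(2N+2) - q^(N+1)(z + 1/z); summation by parts moves the shift
from `rq` to p. -/
theorem sum_rq_succ (N : ℕ) (p pm : ℕ → ℚ⟦X⟧) (h0 : pm 0 = - p 0) (h1 : ∀ n, pm (n + 1) = p n) :
    ∑ n ∈ Finset.range (N + 2), rq (N + 1) n * p n =
      (1 + X ^ (2 * N + 2)) * ∑ n ∈ Finset.range (N + 1), rq N n * p n
      - X ^ (N + 1) * ∑ n ∈ Finset.range (N + 1), rq N n * (p (n + 1) + pm n) := by
  rw [← sum_reflect (rq N) p pm h0 h1 N (rq_eq_zero (by omega)) (rq_eq_zero (by omega)),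
    Finset.sum_range_succ', rq_succ_zero]
  have e : ∑ n ∈ Finset.range (N + 1), rq N n * p n =
      ∑ n ∈ Finset.range (N + 1), rq N (n + 1) * p (n + 1) + rq N 0 * p 0 := by
    rw [← Finset.sum_range_succ' (fun n => rq N n * p n), Finset.sum_range_succ _ (N + 1), rq_eq_zero (n := N + 1) (by omega),
      zero_mul, add_zero]
  rw [e]
  simp only [rq_succ_succ, sub_mul, Finset.sum_sub_distrib, mul_assoc, ← Finset.mul_sum]
  ring

/-- Finite form of the triple product expansion of `∏ (1 + x q ^ k / (1 - q ^ k) ^ 2)`. -/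
theorem qP_sq_mul_esum (N a : ℕ) :
    qP N ^ 2 * esum xq N a = ∑ n ∈ Finset.range (N + 1), rq N n * C (pc a n) := by
  induction N generalizing a with
  | zero =>
    have : rq 0 0 = 1 := by
      simp [rq, qR, invqP, qP]
    cases a with
    | zero => simp [esum_zero_right, qP, this, pc, pf]
    | succ a =>
      simp [esum_eq_zero, pc_succ_zero]
  | succ N ih =>
    -- The new factor is (1 - q^(N+1))^2 + x q^(N+1) = 1 + q^(2N+2) - q^(N+1)(z + 1/z). The
    -- subtraction n - 1 is rational, so n = 0 gives `pc a (-1)`.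
    have key := fun a : ℕ => sum_rq_succ N (fun n => C (pc a n)) (fun n => C (pc a (n - 1)))
      (by simp [pc_neg_one]) (by intro n; push_cast; ring_nf)
    rw [key a, qP_succ]
    cases a with
    | zero =>
      have h : ∀ n : ℕ, C (pc 0 ((n + 1 : ℕ) : ℚ)) + C (pc 0 ((n : ℚ) - 1))
          = C (2 : ℚ) * C (pc 0 (n : ℚ)) := fun n => by
        rw [← map_add, ← map_mul]; push_cast; rw [pc_zero_three_term]
      simp only [h, mul_left_comm _ (C (2 : ℚ)), ← Finset.mul_sum, ← ih, esum_zero_right]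
      simp only [map_ofNat]
      ring
    | succ a =>
      have h : ∀ n : ℕ, C (pc (a + 1) ((n + 1 : ℕ) : ℚ)) + C (pc (a + 1) ((n : ℚ) - 1))
          = C (2 : ℚ) * C (pc (a + 1) (n : ℚ)) - C (pc a n) := fun n => by
        rw [← map_add, ← map_mul, ← map_sub]; push_cast; rw [pc_three_term]
      simp only [h, mul_sub, Finset.sum_sub_distrib, mul_left_comm _ (C (2 : ℚ)),
        ← Finset.mul_sum, ← ih, esum_succ_succ]
      simp only [map_ofNat]
      linear_combination qP N ^ 2 * esum xq N a * one_sub_sq_mul_xq N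


/-! ### Passage to the limit and the heat equation -/

/-- The Euler operator `q d/dq`. -/
def D : Derivation ℚ ℚ⟦X⟧ ℚ⟦X⟧ := (X : ℚ⟦X⟧) • derivative ℚ

theorem coeff_D (f : ℚ⟦X⟧) (n : ℕ) : coeff n (D f) = n * coeff n f := by
  have : D f = X * derivative ℚ f := rfl
  rw [this]
  cases n with
  | zero => simp
  | succ n => rw [coeff_succ_X_mul, coeff_derivative]; push_cast; ring

theorem D_C (r : ℚ) : D (C r) = 0 := D.map_algebraMap r

theorem D_X_pow (k : ℕ) : D (X ^ k) = (k : ℚ⟦X⟧) * X ^ k := by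
  ext n
  rw [coeff_D, ← map_natCast (C (R := ℚ)), coeff_C_mul, coeff_X_pow]
  split_ifs with h <;> simp [h]

theorem X_pow_dvd_D {N : ℕ} {f : ℚ⟦X⟧} (h : X ^ N ∣ f) : X ^ N ∣ D f := by
  rw [X_pow_dvd_iff] at *
  intro m hm
  rw [coeff_D, h m hm, mul_zero]

theorem eq_of_forall_X_pow_dvd {f g : ℚ⟦X⟧} (h : ∀ N : ℕ, X ^ (N + 1) ∣ f - g) : f = g := by
  ext n
  have := X_pow_dvd_iff.mp (h n) n n.lt_succ_self
  rwa [map_sub, sub_eq_zero] at this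

/-- Partial sums of `∑ (-1) ^ n pc a n q ^ (n (n + 1) / 2)`. -/
def theta (N a : ℕ) : ℚ⟦X⟧ :=
  ∑ n ∈ Finset.range (N + 1), (-1) ^ n * X ^ (n * (n + 1) / 2) * C (pc a n)

theorem X_pow_dvd_qP_mul_rq_sub {N n : ℕ} (h : n ≤ N) :
    X ^ (N + 1) ∣ qP N * rq N n - (-1) ^ n * X ^ (n * (n + 1) / 2) := by
  obtain ⟨m, rfl⟩ := Nat.exists_eq_add_of_le h
  have h1 := X_pow_dvd_qP_sub m n
  have h2 := (pow_dvd_pow X (show m + 1 ≤ m + 2 * n + 1 + 1 by omega)).trans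
    (X_pow_dvd_qP_sub (m + 2 * n + 1) m)
  have i1 := qP_mul_inv m
  have i2 := qP_mul_inv (m + 2 * n + 1)
  have e : qP (n + m) * rq (n + m) n - (-1) ^ n * X ^ (n * (n + 1) / 2) =
      X ^ (n * (n + 1) / 2) * ((qP (m + n) - qP m) * qP (m + 2 * n + 1 + m)
        + (qP (m + 2 * n + 1 + m) - qP (m + 2 * n + 1)) * qP m) *
        ((-1) ^ n * (qP m)⁻¹ * (qP (m + 2 * n + 1))⁻¹) := by
    rw [rq, qR, show n + m + 1 - n = m + 1 by omega,
      show n + m + 2 + n = m + 2 * n + 1 + 1 by ring, invqP, invqP,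
      show 2 * (n + m) + 1 = m + 2 * n + 1 + m by ring, add_comm n m]
    linear_combination (-1) ^ n * X ^ (n * (n + 1) / 2) *
      (i1 * qP (m + 2 * n + 1) * (qP (m + 2 * n + 1))⁻¹ + i2)
  rw [e]
  refine Dvd.dvd.mul_right ?_ _
  -- The q-binomial is only accurate modulo q^(N-n+1); the triangular exponent supplies the missing
  -- n powers.
  have h3 : n ≤ n * (n + 1) / 2 := by
    rw [Nat.le_div_iff_mul_le two_pos]
    cases n with
    | zero => simp
    | succ n => exact Nat.mul_le_mul_left _ (by omega)
  refine (pow_dvd_pow X (show n + m + 1 ≤ n * (n + 1) / 2 + (m + 1) by omega)).trans ?_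
  rw [pow_add]
  exact mul_dvd_mul_left _ (dvd_add (h1.mul_right _) (h2.mul_right _))

/-- For a = 0 this is Jacobi's series for (q; q)_∞^3, truncated. -/
theorem X_pow_dvd_qP_cube_mul_esum_sub (N a : ℕ) :
    X ^ (N + 1) ∣ qP N ^ 3 * esum xq N a - theta N a := by
  rw [pow_succ' (qP N), mul_assoc, qP_sq_mul_esum, theta, Finset.mul_sum, ← Finset.sum_sub_distrib]
  refine Finset.dvd_sum fun n hn => ?_
  rw [← mul_assoc, ← sub_mul]
  exact (X_pow_dvd_qP_mul_rq_sub (by simpa [Nat.lt_succ_iff] using hn)).mul_right _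

theorem D_theta (N a : ℕ) : D (theta N a) =
    C ((a : ℚ) * (a + 1) / 2) * theta N a
      - C ((2 * (a : ℚ) + 3) * (a + 1)) * theta N (a + 1) := by
  simp only [theta, map_sum, Finset.mul_sum, ← Finset.sum_sub_distrib]
  refine Finset.sum_congr rfl fun n _ => ?_
  have h := congrArg (C (R := ℚ)) (mul_pc a n)
  have hn : ((n * (n + 1) / 2 : ℕ) : ℚ) = n * (n + 1) / 2 := by
    rw [Nat.cast_div (Nat.even_mul_succ_self n).two_dvd (by norm_num)]; push_cast; ring
  simp only [map_mul, map_sub] at h ⊢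
  rw [Derivation.leibniz, D_C, Derivation.leibniz, D_X_pow, smul_zero, zero_add,
    show ((-1) ^ n : ℚ⟦X⟧) = C ((-1) ^ n) by simp, D_C, smul_zero, add_zero,
    ← map_natCast (C (R := ℚ)), hn]
  simp only [smul_eq_mul]
  linear_combination C ((-1) ^ n) * X ^ (n * (n + 1) / 2) * h

theorem term_map_succ (t : Finset ℕ) :
    term (t.map Equiv.pnatEquivNat.symm.toEmbedding) = ∏ k ∈ t, xq k := by
  rw [term, Finset.prod_map]
  rfl

/-- A set containing some k > N contributes a multiple of q^(N+1); the others are shifted subsets of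
`range N`. -/
theorem X_pow_dvd_U_sub_esum (N a : ℕ) : X ^ (N + 1) ∣ U a - esum xq N a := by
  rw [X_pow_dvd_iff]
  intro n hn
  rw [map_sub, sub_eq_zero]
  have hs : HasSum (fun s : {s : Finset ℕ+ // s.card = a} => coeff n (term s.1)) (coeff n (U a)) :=
    (hasSum_U a).map (coeff n) (WithPiTopology.continuous_coeff ℚ n)
  let g : (Finset.range N).powersetCard a → {s : Finset ℕ+ // s.card = a} := fun t =>
    ⟨t.1.map Equiv.pnatEquivNat.symm.toEmbedding, by
      rw [Finset.card_map]; exact (Finset.mem_powersetCard.mp t.2).2⟩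
  have hg : Function.Injective g := fun t t' h =>
    Subtype.ext (Finset.map_injective _ (congrArg Subtype.val h))
  rw [← hg.hasSum_iff] at hs
  · rw [hs.unique (hasSum_fintype _), esum, map_sum,
      ← Finset.sum_coe_sort ((Finset.range N).powersetCard a)]
    refine Finset.sum_congr rfl fun t _ => ?_
    simp only [Function.comp, g, term_map_succ]
  · intro s hsr
    by_cases hk : ∃ k ∈ s.1, N < (k : ℕ)
    · obtain ⟨k, hk, hkN⟩ := hk
      have hdvd : (X : ℚ⟦X⟧) ^ (k : ℕ) ∣ term s.1 :=
        (Dvd.intro _ rfl).trans (Finset.dvd_prod_of_mem _ hk)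
      exact (X_pow_dvd_iff.mp hdvd) n (by omega)
    · push Not at hk
      refine absurd ⟨⟨s.1.map Equiv.pnatEquivNat.toEmbedding, ?_⟩, ?_⟩ hsr
      · rw [Finset.mem_powersetCard, Finset.card_map]
        refine ⟨fun k hk' => ?_, s.2⟩
        obtain ⟨j, hj, rfl⟩ := Finset.mem_map.mp hk'
        have := hk j hj
        have := j.pos
        simp [Equiv.pnatEquivNat, PNat.natPred]
        omega
      · apply Subtype.ext
        ext k
        simp [g]

/-- The heat equation for the theta function, as a recursion for MacMahon's series. -/
theorem D_U (a : ℕ) : D (U a) = 3 * U 1 * U a + C ((a : ℚ) * (a + 1) / 2) * U a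
    - C ((2 * (a : ℚ) + 3) * (a + 1)) * U (a + 1) := by
  refine eq_of_forall_X_pow_dvd fun N => ?_
  have hU := fun a => X_pow_dvd_U_sub_esum N a
  have hT : ∀ a, X ^ (N + 1) ∣ qP N ^ 3 * U a - theta N a := fun a => by
    convert dvd_add ((hU a).mul_left (qP N ^ 3)) (X_pow_dvd_qP_cube_mul_esum_sub N a) using 1
    ring
  have hU0 : X ^ (N + 1) ∣ U 0 - 1 := by simpa [esum_zero_right] using hU 0
  have hD := fun a => X_pow_dvd_D (hT a)
  -- Since U_0 ≡ 1, the cube of `qP N` is itself theta at a = 0, so D(qP^3) ≡ -3 qP^3 U_1: the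
  -- source of the term 3 U_1 U_a.
  have hQ0 : X ^ (N + 1) ∣ qP N ^ 3 - theta N 0 := by
    convert dvd_sub (hT 0) (hU0.mul_left (qP N ^ 3)) using 1
    ring
  have hQ := X_pow_dvd_D hQ0
  rw [map_sub, D_theta] at hQ
  have hu : IsUnit (qP N ^ 3) := by
    rw [isUnit_iff_constantCoeff]; simp [constantCoeff_qP]
  rw [← hu.dvd_mul_left]
  have ha := hD a
  rw [map_sub, D_theta, Derivation.leibniz] at ha
  simp only [smul_eq_mul] at ha
  obtain ⟨u, hu⟩ := ha
  obtain ⟨v, hv⟩ := hQ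
  obtain ⟨w0, hw0⟩ := hT a
  obtain ⟨w1, hw1⟩ := hT (a + 1)
  obtain ⟨w2, hw2⟩ := hT 1
  have h3 : C ((2 * ((0 : ℕ) : ℚ) + 3) * ((0 : ℕ) + 1)) = (3 : ℚ⟦X⟧) := by
    rw [← map_ofNat (C (R := ℚ)) 3]; norm_num
  have h0 : C (((0 : ℕ) : ℚ) * ((0 : ℕ) + 1) / 2) = (0 : ℚ⟦X⟧) := by simp
  rw [h3, h0] at hv
  refine ⟨u - U a * v - 3 * U a * w2 - C ((a : ℚ) * (a + 1) / 2) * w0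
    + C ((2 * (a : ℚ) + 3) * (a + 1)) * w1, ?_⟩
  linear_combination hu - U a * hv - 3 * U a * hw2 - C ((a : ℚ) * (a + 1) / 2) * hw0
    + C ((2 * (a : ℚ) + 3) * (a + 1)) * hw1


/-! ### Lambert series and divisor sums -/

/-- The Lambert-type series `∑_m m ^ j q ^ (m (k + 1))`. -/
def lam (k j : ℕ) : ℚ⟦X⟧ :=
  PowerSeries.mk fun n => if (k + 1) ∣ n then ((n / (k + 1) : ℕ) : ℚ) ^ j else 0

theorem D_lam (k j : ℕ) : D (lam k j) = C ((k : ℚ) + 1) * lam k (j + 1) := by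
  ext n
  rw [coeff_D, coeff_C_mul, lam, lam, coeff_mk, coeff_mk]
  split_ifs with h
  · obtain ⟨m, rfl⟩ := h
    rw [Nat.mul_div_cancel_left _ k.succ_pos]
    push_cast
    ring
  · simp

theorem lam_zero (k : ℕ) : lam k 0 * (1 - X ^ (k + 1)) = 1 := by
  ext n
  rw [mul_sub, mul_one, map_sub, coeff_mul_X_pow', coeff_one, lam, coeff_mk]
  rcases eq_or_ne n 0 with rfl | hn
  · simp
  · simp only [pow_zero, hn, if_false, coeff_mk]
    by_cases hk : k + 1 ≤ n
    · simp only [hk, if_true]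
      simp only [Nat.dvd_sub_iff_left hk dvd_rfl, sub_self]
    · simp [hk, Nat.not_dvd_of_pos_of_lt (Nat.pos_of_ne_zero hn) (not_le.mp hk)]

/-- With g = 1/(1 - q^(k+1)) one has q^(k+1) g = g - 1, hence g^2 q^(k+1) = g^2 - g. -/
theorem xq_eq (k : ℕ) : xq k = lam k 0 ^ 2 - lam k 0 := by
  have h := lam_zero k
  have h2 := one_sub_sq_mul_xq k
  have h3 : lam k 0 * X ^ (k + 1) = lam k 0 - 1 := by linear_combination -h
  linear_combination lam k 0 ^ 2 * h2 + lam k 0 * h3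
    - (lam k 0 * (1 - X ^ (k + 1)) + 1) * xq k * h

theorem C_succ_ne_zero (k : ℕ) : (C ((k : ℚ) + 1) : ℚ⟦X⟧) ≠ 0 := by
  rw [Ne, map_eq_zero_iff _ (C_injective (R := ℚ))]
  positivity

theorem D_lam_zero (k : ℕ) : D (lam k 0) = C ((k : ℚ) + 1) * xq k := by
  have h := lam_zero k
  have hD := congrArg D h
  rw [Derivation.leibniz, map_sub, D_X_pow, Derivation.map_one_eq_zero] at hD
  simp only [smul_eq_mul] at hD
  have hc : ((k + 1 : ℕ) : ℚ⟦X⟧) = C ((k : ℚ) + 1) := by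
    rw [← map_natCast (C (R := ℚ))]; push_cast; rfl
  rw [hc] at hD
  rw [xq_eq]
  linear_combination lam k 0 * hD - D (lam k 0) * h - lam k 0 * C ((k : ℚ) + 1) * h

theorem lam_one (k : ℕ) : lam k 1 = xq k :=
  mul_left_cancel₀ (C_succ_ne_zero k) ((D_lam k 0).symm.trans (D_lam_zero k))

theorem D_xq (k : ℕ) : D (xq k) = C ((k : ℚ) + 1) * ((2 * lam k 0 - 1) * xq k) := by
  rw [xq_eq, map_sub, Derivation.leibniz_pow, D_lam_zero, xq_eq]
  simp only [nsmul_eq_mul, smul_eq_mul]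
  push_cast
  ring

theorem lam_add_two {k j : ℕ} {P : ℚ⟦X⟧} (h : D (D (lam k j)) = C ((k : ℚ) + 1) ^ 2 * P) :
    lam k (j + 2) = P := by
  refine mul_left_cancel₀ (pow_ne_zero 2 (C_succ_ne_zero k)) (h ▸ ?_)
  rw [D_lam, Derivation.leibniz, D_C, D_lam]
  simp only [smul_eq_mul]
  ring

/-- With `D_xq_sq`, a degenerate Weierstrass equation u'' = u + 6u², u'² = u² + 4u³, which makes the
odd `lam k j` below polynomials in `xq k`. -/
theorem D_D_xq (k : ℕ) : D (D (xq k)) = C ((k : ℚ) + 1) ^ 2 * (xq k + 6 * xq k ^ 2) := by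
  rw [D_xq, Derivation.leibniz, D_C, Derivation.leibniz, D_xq, map_sub, Derivation.leibniz,
    D_lam_zero, Derivation.map_one_eq_zero, ← map_ofNat (C (R := ℚ)) 2, D_C]
  simp only [smul_eq_mul, map_ofNat]
  linear_combination (-4 * C ((k : ℚ) + 1) ^ 2 * xq k) * xq_eq k

theorem D_xq_sq (k : ℕ) : D (xq k) ^ 2 = C ((k : ℚ) + 1) ^ 2 * (xq k ^ 2 + 4 * xq k ^ 3) := by
  rw [D_xq]
  linear_combination (-4 * C ((k : ℚ) + 1) ^ 2 * xq k ^ 2) * xq_eq k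

theorem lam_three (k : ℕ) : lam k 3 = xq k + 6 * xq k ^ 2 :=
  lam_add_two (by rw [lam_one, D_D_xq])

theorem D_ofNat_mul (n : ℕ) [n.AtLeastTwo] (f : ℚ⟦X⟧) :
    D ((ofNat(n) : ℚ⟦X⟧) * f) = (ofNat(n) : ℚ⟦X⟧) * D f := by
  rw [← map_ofNat (C (R := ℚ)) n, Derivation.leibniz, D_C, smul_zero, add_zero, smul_eq_mul]

theorem D_mul (f g : ℚ⟦X⟧) : D (f * g) = f * D g + g * D f := D.leibniz f g

theorem D_sq (f : ℚ⟦X⟧) : D (f ^ 2) = 2 * (f * D f) := by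
  rw [sq, D_mul]; ring

theorem D_cube (f : ℚ⟦X⟧) : D (f ^ 3) = 3 * (f ^ 2 * D f) := by
  rw [pow_succ, D_mul, D_sq]; ring

theorem lam_five (k : ℕ) : lam k 5 = xq k + 30 * xq k ^ 2 + 120 * xq k ^ 3 := by
  refine lam_add_two ?_
  rw [lam_three]
  simp only [Derivation.map_add, D_ofNat_mul, D_sq, D_mul, D_D_xq]
  linear_combination 12 * D_xq_sq k

theorem lam_seven (k : ℕ) :
    lam k 7 = xq k + 126 * xq k ^ 2 + 1680 * xq k ^ 3 + 5040 * xq k ^ 4 := by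
  refine lam_add_two ?_
  rw [lam_five]
  simp only [Derivation.map_add, D_ofNat_mul, D_sq, D_cube, D_mul, D_D_xq]
  linear_combination (60 + 720 * xq k) * D_xq_sq k

/-- `∑ σ_j(n) q ^ n`. -/
def S (j : ℕ) : ℚ⟦X⟧ := PowerSeries.mk fun n => (ArithmeticFunction.sigma j n : ℚ)

theorem X_pow_dvd_S_sub_sum_lam (N j : ℕ) (hj : j ≠ 0) :
    X ^ (N + 1) ∣ S j - ∑ k ∈ Finset.range N, lam k j := by
  rw [X_pow_dvd_iff]
  intro n hn
  rw [map_sub, map_sum, S, coeff_mk, sub_eq_zero]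
  simp only [lam, coeff_mk]
  rcases eq_or_ne n 0 with rfl | h0
  -- In degree 0 each Lambert series contributes 0^j, which is 0 only for j ≠ 0.
  · simp [hj]
  have hd : n.divisors = (Finset.Ico 1 (N + 1)).filter (· ∣ n) := by
    ext d
    simp only [Nat.mem_divisors, Finset.mem_filter, Finset.mem_Ico]
    constructor
    · rintro ⟨h, -⟩
      have := Nat.le_of_dvd (Nat.pos_of_ne_zero h0) h
      exact ⟨⟨Nat.pos_of_dvd_of_pos h (Nat.pos_of_ne_zero h0), by omega⟩, h⟩
    · exact fun h => ⟨h.2, h0⟩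
  rw [ArithmeticFunction.sigma_apply, ← Nat.sum_div_divisors n (fun d => d ^ j), hd,
    Finset.sum_filter, Finset.sum_Ico_eq_sum_range]
  push_cast
  simp only [add_comm 1]

/-- Reduction modulo `q ^ (N + 1)`. -/
def red (N : ℕ) : ℚ⟦X⟧ →+* ℚ⟦X⟧ ⧸ Ideal.span {(X : ℚ⟦X⟧) ^ (N + 1)} := Ideal.Quotient.mk _

theorem red_eq_iff {N : ℕ} {f g : ℚ⟦X⟧} : red N f = red N g ↔ X ^ (N + 1) ∣ f - g := by
  rw [red, Ideal.Quotient.mk_eq_mk_iff_sub_mem, Ideal.mem_span_singleton]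

theorem eq_of_red_eq {f g : ℚ⟦X⟧} (h : ∀ N, red N f = red N g) : f = g :=
  eq_of_forall_X_pow_dvd fun N => red_eq_iff.mp (h N)

theorem red_U (N a : ℕ) : red N (U a) = red N (esum xq N a) :=
  red_eq_iff.mpr (X_pow_dvd_U_sub_esum N a)

theorem red_S (N j : ℕ) (hj : j ≠ 0) : red N (S j) = red N (∑ k ∈ Finset.range N, lam k j) :=
  red_eq_iff.mpr (X_pow_dvd_S_sub_sum_lam N j hj)

/-- Partial power sums of the `q ^ k / (1 - q ^ k) ^ 2`. -/
def psum (N j : ℕ) : ℚ⟦X⟧ := ∑ k ∈ Finset.range N, xq k ^ j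

theorem red_S_one (N : ℕ) : red N (S 1) = red N (psum N 1) := by
  rw [red_S N 1 one_ne_zero]; simp only [lam_one, psum, pow_one]

theorem red_S_three (N : ℕ) : red N (S 3) = red N (psum N 1 + 6 * psum N 2) := by
  rw [red_S N 3 (by norm_num)]
  simp only [lam_three, psum, pow_one, Finset.sum_add_distrib, Finset.mul_sum]

theorem red_S_five (N : ℕ) :
    red N (S 5) = red N (psum N 1 + 30 * psum N 2 + 120 * psum N 3) := by
  rw [red_S N 5 (by norm_num)]
  simp only [lam_five, psum, pow_one, Finset.sum_add_distrib, Finset.mul_sum]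

theorem red_S_seven (N : ℕ) : red N (S 7) =
    red N (psum N 1 + 126 * psum N 2 + 1680 * psum N 3 + 5040 * psum N 4) := by
  rw [red_S N 7 (by norm_num)]
  simp only [lam_seven, psum, pow_one, Finset.sum_add_distrib, Finset.mul_sum]

theorem U_zero : U 0 = 1 := eq_of_red_eq fun N => by rw [red_U, esum_zero_right]

theorem U_one : U 1 = S 1 := eq_of_red_eq fun N => by
  rw [red_U, esum_one, red_S_one]; simp only [psum, pow_one]

/-- Newton's identities for U_2, U_3, U_4, with the power sums p_j of the q^k/(1-q^k)^2 obtained by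
inverting a triangular system: 6 p_2 = S_3 - S_1, 120 p_3 = S_5 - 5 S_3 + 4 S_1, and similarly p_4.
-/
theorem U_two : 12 * U 2 = 6 * S 1 ^ 2 - (S 3 - S 1) := eq_of_red_eq fun N => by
  have h := congrArg (red N) (two_mul_esum_two xq N)
  simp only [map_mul, map_sub, map_pow, map_ofNat, red_U, red_S_one, red_S_three, map_add] at h ⊢
  simp only [psum, pow_one] at h ⊢
  linear_combination 6 * h

theorem U_three : 360 * U 3 = 60 * S 1 ^ 3 - 30 * S 1 * (S 3 - S 1) + (S 5 - 5 * S 3 + 4 * S 1) :=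
  eq_of_red_eq fun N => by
  have h := congrArg (red N) (six_mul_esum_three xq N)
  simp only [map_mul, map_sub, map_pow, map_ofNat, red_U, red_S_one, red_S_three, red_S_five,
    map_add] at h ⊢
  simp only [psum, pow_one] at h ⊢
  linear_combination 60 * h

theorem U_four : 24 * 5040 * U 4 = 5040 * S 1 ^ 4 - 5040 * S 1 ^ 2 * (S 3 - S 1)
    + 420 * (S 3 - S 1) ^ 2 + 336 * S 1 * (S 5 - 5 * S 3 + 4 * S 1)
    - 6 * (S 7 - 14 * S 5 + 49 * S 3 - 36 * S 1) := eq_of_red_eq fun N => by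
  have h := congrArg (red N) (twentyFour_mul_esum_four xq N)
  simp only [map_mul, map_sub, map_pow, map_ofNat, red_U, red_S_one, red_S_three, red_S_five,
    red_S_seven, map_add] at h ⊢
  simp only [psum, pow_one] at h ⊢
  linear_combination 5040 * h

/-! ### Ramanujan's differential equations -/

theorem E₂_eq : E₂ = 1 - 24 * S 1 := rfl

theorem E₄_eq : E₄ = 1 + 240 * S 3 := rfl

theorem E₆_eq : E₆ = 1 - 504 * S 5 := rfl

theorem D_U_one : D (U 1) = 3 * U 1 ^ 2 + U 1 - 10 * U 2 := by
  rw [D_U, show ((1 : ℕ) : ℚ) * ((1 : ℕ) + 1) / 2 = 1 by norm_num,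
    show (2 * ((1 : ℕ) : ℚ) + 3) * ((1 : ℕ) + 1) = 10 by norm_num, map_one, map_ofNat]
  ring

theorem D_U_two : D (U 2) = 3 * U 1 * U 2 + 3 * U 2 - 21 * U 3 := by
  rw [D_U, show ((2 : ℕ) : ℚ) * ((2 : ℕ) + 1) / 2 = 3 by norm_num,
    show (2 * ((2 : ℕ) : ℚ) + 3) * ((2 : ℕ) + 1) = 21 by norm_num, map_ofNat, map_ofNat]

theorem D_U_three : D (U 3) = 3 * U 1 * U 3 + 6 * U 3 - 36 * U 4 := by
  rw [D_U, show ((3 : ℕ) : ℚ) * ((3 : ℕ) + 1) / 2 = 6 by norm_num,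
    show (2 * ((3 : ℕ) : ℚ) + 3) * ((3 : ℕ) + 1) = 36 by norm_num, map_ofNat, map_ofNat]

/-- The heat equation at a = 1 with U_2 eliminated; D E₄ and D E₆ use a = 2, 3 and the derivatives
of `U_two`, `U_three`. -/
theorem D_E₂ : 12 * D E₂ = E₂ ^ 2 - E₄ := by
  have h := D_U_one
  rw [U_one] at h
  rw [E₂_eq, E₄_eq, map_sub, Derivation.map_one_eq_zero, D_ofNat_mul]
  linear_combination -288 * h + 240 * U_two

theorem D_E₄ : 3 * D E₄ = E₂ * E₄ - E₆ := by
  have h1 := D_U_one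
  have h2 := D_U_two
  rw [U_one] at h1 h2
  have h3 := congrArg D U_two
  simp only [map_sub, D_ofNat_mul, D_sq] at h3
  rw [E₂_eq, E₄_eq, E₆_eq, map_add, Derivation.map_one_eq_zero, D_ofNat_mul]
  linear_combination 720 * h3 - 8640 * h2 + (8640 * S 1 + 720) * h1
    + (-9360 * S 1 - 2760) * U_two + 504 * U_three

theorem D_E₆ : 2 * D E₆ = E₂ * E₆ - E₄ ^ 2 := by
  have h1 := D_E₂
  have h2 := D_E₄
  have h3 := D_U_three
  -- U_4 brings in S_7, which E₈ = E₄² removes.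
  have h8 : S 7 = S 3 + 120 * S 3 ^ 2 := by
    have h : 1 + 480 * S 7 = E₄ ^ 2 := E₈_eq_sq
    rw [E₄_eq] at h
    refine mul_left_cancel₀ (show (480 : ℚ⟦X⟧) ≠ 0 by
      rw [← map_ofNat (C (R := ℚ)), Ne, map_eq_zero_iff _ (C_injective (R := ℚ))]; norm_num) ?_
    linear_combination h
  rw [U_one] at h3
  have h4 := congrArg D U_three
  simp only [map_sub, map_add, D_ofNat_mul, D_cube, D_mul] at h4
  rw [E₂_eq, map_sub, Derivation.map_one_eq_zero, D_ofNat_mul, E₄_eq] at h1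
  rw [E₂_eq, E₄_eq, E₆_eq, map_add, Derivation.map_one_eq_zero, D_ofNat_mul] at h2
  rw [E₂_eq, E₄_eq, E₆_eq, map_sub, Derivation.map_one_eq_zero, D_ofNat_mul]
  linear_combination 1008 * h4 - 1008 * 360 * h3
    + (-630 * S 1 ^ 2 + 105 * S 3 - 210 * S 1 - 14) * h1 - (42 * S 1 + 7) * h2
    - 1008 * (3 * S 1 + 6) * U_three + 108 * U_four - 648 * h8


/-! ### The operator L on monomials -/

/-- The operator `-(8 D + E₂)`. -/
def L (f : ℚ⟦X⟧) : ℚ⟦X⟧ := -(8 * D f + E₂ * f)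

theorem L_smul (r : ℚ) (f : ℚ⟦X⟧) : L (r • f) = r • L f := by
  simp only [L, smul_eq_C_mul, D_mul, D_C]; ring

theorem L_sum {ι : Type*} (s : Finset ι) (f : ι → ℚ⟦X⟧) : L (∑ i ∈ s, f i) = ∑ i ∈ s, L (f i) := by
  simp only [L, map_sum, Finset.mul_sum, ← Finset.sum_add_distrib, ← Finset.sum_neg_distrib]

/-- The monomial `E₂ ^ α E₄ ^ β E₆ ^ γ`. -/
def mon (p : ℕ × ℕ × ℕ) : ℚ⟦X⟧ := E₂ ^ p.1 * E₄ ^ p.2.1 * E₆ ^ p.2.2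

theorem D_pow (f : ℚ⟦X⟧) (n : ℕ) : D (f ^ n) = (n : ℚ⟦X⟧) * f ^ (n - 1) * D f := by
  rw [Derivation.leibniz_pow, nsmul_eq_mul, smul_eq_mul, mul_assoc]

theorem natCast_mul_pow_pred (f : ℚ⟦X⟧) (n : ℕ) : (n : ℚ⟦X⟧) * f ^ (n - 1) * f = n * f ^ n := by
  cases n with
  | zero => simp
  | succ n => rw [Nat.add_sub_cancel, pow_succ]; ring

/-- Leibniz and Ramanujan's formulas. Truncated exponents are harmless, as their coefficients a, b,
g then vanish. -/
theorem L_mon (a b g : ℕ) : L (mon (a, b, g)) =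
    (-(1 / 3) * (2 * (a : ℚ) + 8 * b + 12 * g + 3)) • mon (a + 1, b, g)
      + (2 / 3 * (a : ℚ)) • mon (a - 1, b + 1, g)
      + (8 / 3 * (b : ℚ)) • mon (a, b - 1, g + 1)
      + (4 * (g : ℚ)) • mon (a, b + 2, g - 1) := by
  have ht : (3 : ℚ⟦X⟧) * C (1 / 3 : ℚ) = 1 := by
    rw [← map_ofNat (C (R := ℚ)), ← map_mul]; norm_num
  have e1 : (C (2 / 3 : ℚ) : ℚ⟦X⟧) = 2 * C (1 / 3 : ℚ) := by
    rw [← map_ofNat (C (R := ℚ)), ← map_mul]; norm_num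
  have e2 : (C (8 / 3 : ℚ) : ℚ⟦X⟧) = 8 * C (1 / 3 : ℚ) := by
    rw [← map_ofNat (C (R := ℚ)), ← map_mul]; norm_num
  have d2 : 8 * D E₂ = 2 * C (1 / 3 : ℚ) * (E₂ ^ 2 - E₄) := by
    linear_combination 2 * C (1 / 3 : ℚ) * D_E₂ - 8 * D E₂ * ht
  have d4 : 8 * D E₄ = 8 * C (1 / 3 : ℚ) * (E₂ * E₄ - E₆) := by
    linear_combination 8 * C (1 / 3 : ℚ) * D_E₄ - 8 * D E₄ * ht
  have d6 := D_E₆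
  have p2 := natCast_mul_pow_pred E₂ a
  have p4 := natCast_mul_pow_pred E₄ b
  have p6 := natCast_mul_pow_pred E₆ g
  simp only [L, mon, smul_eq_C_mul, map_mul, map_neg, map_add, map_natCast, map_ofNat, D_mul,
    D_pow, e1, e2]
  set A := E₂ ^ (a - 1)
  set B := E₄ ^ (b - 1)
  set G := E₆ ^ (g - 1)
  simp only [pow_succ]
  linear_combination (-(E₄ ^ b * E₆ ^ g * (a * A))) * d2 - (E₂ ^ a * E₆ ^ g * (b * B)) * d4
    - 4 * (E₂ ^ a * E₄ ^ b * (g * G)) * d6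
    - 2 * C (1 / 3 : ℚ) * E₂ * E₄ ^ b * E₆ ^ g * p2
    - 8 * C (1 / 3 : ℚ) * E₂ * E₂ ^ a * E₆ ^ g * p4
    - 4 * E₂ * E₂ ^ a * E₄ ^ b * p6
    + (E₂ * E₂ ^ a * E₄ ^ b * E₆ ^ g) * (4 * g + 1) * ht

theorem c_of_neg {x y z : ℤ} (h : x < 0 ∨ y < 0 ∨ z < 0) : c x y z = 0 := by
  rw [c, if_pos h]

theorem c_zero : c 0 0 0 = 1 := by
  rw [c]; simp

theorem c_rec (a b g : ℕ) (h : a + 2 * b + 3 * g ≠ 0) : c a b g =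
    -(1 / 3) * (2 * a + 8 * b + 12 * g + 1) * c (a - 1) b g
      + 2 / 3 * (a + 1) * c (a + 1) (b - 1) g
      + 8 / 3 * (b + 1) * c a (b + 1) (g - 1)
      + 4 * (g + 1) * c a (b - 2) (g + 1) := by
  rw [c, if_neg (by omega), if_neg (by omega)]
  push_cast
  rfl

/-- Reindexing along shifts of exponents, which are mutually inverse on ℕ only away from vanishing
terms. -/
theorem sum_eq_sum_of_partial_inverse {ι M : Type*} [AddCommMonoid M] {s t : Finset ι}
    {F G : ι → M} (φ ψ : ι → ι) (hs : ∀ p ∈ s, F p = 0 ∨ (φ p ∈ t ∧ ψ (φ p) = p))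
    (ht : ∀ p ∈ t, G p = 0 ∨ (ψ p ∈ s ∧ φ (ψ p) = p))
    (hFG : ∀ p, ψ (φ p) = p → F p = G (φ p)) : ∑ p ∈ s, F p = ∑ p ∈ t, G p := by
  refine Finset.sum_bij_ne_zero (fun p _ _ => φ p) ?_ ?_ ?_ ?_
  · exact fun p hp h0 => ((hs p hp).resolve_left h0).1
  · intro p hp h0 q hq h1 e
    rw [← ((hs p hp).resolve_left h0).2, e, ((hs q hq).resolve_left h1).2]
  · intro p hp h0
    obtain ⟨h1, h2⟩ := (ht p hp).resolve_left h0
    exact ⟨ψ p, h1, by rwa [hFG _ (congrArg ψ h2), h2], h2⟩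
  · exact fun p hp h0 => hFG p ((hs p hp).resolve_left h0).2

/-- The weight `2t` quasimodular polynomial `∑ c(α, β, γ) E₂ ^ α E₄ ^ β E₆ ^ γ`. -/
def quasi (t : ℕ) : ℚ⟦X⟧ := ∑ p ∈ triples t, c p.1 p.2.1 p.2.2 • mon p

theorem quasi_zero : quasi 0 = 1 := by
  have : triples 0 = {(0, 0, 0)} := by
    ext ⟨a, b, g⟩
    rw [mem_triples]; simp; omega
  rw [quasi, this]
  simp [mon, c_zero]

/-- Each of `e1`–`e4` collects one term of `L_mon` by target monomial; the 2α + 3 there becomes 2α +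
1 since α is lowered by one. -/
theorem quasi_succ (t : ℕ) : quasi (t + 1) = L (quasi t) := by
  have e1 : ∑ p ∈ triples t,
      (c p.1 p.2.1 p.2.2 * (-(1 / 3) * (2 * (p.1 : ℚ) + 8 * p.2.1 + 12 * p.2.2 + 3))) •
        mon (p.1 + 1, p.2.1, p.2.2) = ∑ p ∈ triples (t + 1),
      (-(1 / 3) * (2 * (p.1 : ℚ) + 8 * p.2.1 + 12 * p.2.2 + 1) * c (p.1 - 1) p.2.1 p.2.2) •
        mon p := by
    refine sum_eq_sum_of_partial_inverse (fun p => (p.1 + 1, p.2.1, p.2.2))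
      (fun p => (p.1 - 1, p.2.1, p.2.2)) ?_ ?_ ?_
    · rintro ⟨a, b, g⟩ h
      rw [mem_triples] at h
      exact Or.inr ⟨by dsimp only; rw [mem_triples]; omega, rfl⟩
    · rintro ⟨a, b, g⟩ h
      rw [mem_triples] at h
      rcases Nat.eq_zero_or_pos a with rfl | ha
      · exact Or.inl (by rw [c_of_neg (by simp)]; simp)
      · refine Or.inr ⟨by dsimp only; rw [mem_triples]; omega, ?_⟩
        simp only [Prod.mk.injEq, and_true]; omega
    · rintro ⟨a, b, g⟩ -
      push_cast
      rw [add_sub_cancel_right]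
      congr 1
      ring
  have e2 : ∑ p ∈ triples t, (c p.1 p.2.1 p.2.2 * (2 / 3 * (p.1 : ℚ))) •
        mon (p.1 - 1, p.2.1 + 1, p.2.2) = ∑ p ∈ triples (t + 1),
      (2 / 3 * ((p.1 : ℚ) + 1) * c (p.1 + 1) (p.2.1 - 1) p.2.2) • mon p := by
    refine sum_eq_sum_of_partial_inverse (fun p => (p.1 - 1, p.2.1 + 1, p.2.2))
      (fun p => (p.1 + 1, p.2.1 - 1, p.2.2)) ?_ ?_ ?_
    · rintro ⟨a, b, g⟩ h
      rw [mem_triples] at h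
      rcases Nat.eq_zero_or_pos a with rfl | ha
      · exact Or.inl (by simp)
      · refine Or.inr ⟨by dsimp only; rw [mem_triples]; omega, ?_⟩
        simp only [Prod.mk.injEq, and_true]; omega
    · rintro ⟨a, b, g⟩ h
      rw [mem_triples] at h
      rcases Nat.eq_zero_or_pos b with rfl | hb
      · exact Or.inl (by rw [c_of_neg (by simp)]; simp)
      · refine Or.inr ⟨by dsimp only; rw [mem_triples]; omega, ?_⟩
        simp only [Prod.mk.injEq, and_true]; omega
    · rintro ⟨a, b, g⟩ h
      -- The round trip fixes the triple only if a ≥ 1, so the truncated a - 1 is exact.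
      obtain ⟨a, rfl⟩ : ∃ a', a = a' + 1 := ⟨a - 1, (congrArg Prod.fst h).symm⟩
      push_cast
      rw [add_sub_cancel_right]
      congr 1
      ring
  have e3 : ∑ p ∈ triples t, (c p.1 p.2.1 p.2.2 * (8 / 3 * (p.2.1 : ℚ))) •
        mon (p.1, p.2.1 - 1, p.2.2 + 1) = ∑ p ∈ triples (t + 1),
      (8 / 3 * ((p.2.1 : ℚ) + 1) * c p.1 (p.2.1 + 1) (p.2.2 - 1)) • mon p := by
    refine sum_eq_sum_of_partial_inverse (fun p => (p.1, p.2.1 - 1, p.2.2 + 1))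
      (fun p => (p.1, p.2.1 + 1, p.2.2 - 1)) ?_ ?_ ?_
    · rintro ⟨a, b, g⟩ h
      rw [mem_triples] at h
      rcases Nat.eq_zero_or_pos b with rfl | hb
      · exact Or.inl (by simp)
      · refine Or.inr ⟨by dsimp only; rw [mem_triples]; omega, ?_⟩
        simp only [Prod.mk.injEq, true_and]; omega
    · rintro ⟨a, b, g⟩ h
      rw [mem_triples] at h
      rcases Nat.eq_zero_or_pos g with rfl | hg
      · exact Or.inl (by rw [c_of_neg (by simp)]; simp)
      · refine Or.inr ⟨by dsimp only; rw [mem_triples]; omega, ?_⟩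
        simp only [Prod.mk.injEq, true_and]; omega
    · rintro ⟨a, b, g⟩ h
      obtain ⟨b, rfl⟩ : ∃ b', b = b' + 1 :=
        ⟨b - 1, (congrArg (fun p : ℕ × ℕ × ℕ => p.2.1) h).symm⟩
      push_cast
      rw [add_sub_cancel_right]
      congr 1
      ring
  have e4 : ∑ p ∈ triples t, (c p.1 p.2.1 p.2.2 * (4 * (p.2.2 : ℚ))) •
        mon (p.1, p.2.1 + 2, p.2.2 - 1) = ∑ p ∈ triples (t + 1),
      (4 * ((p.2.2 : ℚ) + 1) * c p.1 (p.2.1 - 2) (p.2.2 + 1)) • mon p := by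
    refine sum_eq_sum_of_partial_inverse (fun p => (p.1, p.2.1 + 2, p.2.2 - 1))
      (fun p => (p.1, p.2.1 - 2, p.2.2 + 1)) ?_ ?_ ?_
    · rintro ⟨a, b, g⟩ h
      rw [mem_triples] at h
      rcases Nat.eq_zero_or_pos g with rfl | hg
      · exact Or.inl (by simp)
      · refine Or.inr ⟨by dsimp only; rw [mem_triples]; omega, ?_⟩
        simp only [Prod.mk.injEq, true_and]; omega
    · rintro ⟨a, b, g⟩ h
      rw [mem_triples] at h
      rcases lt_or_ge b 2 with hb | hb
      · exact Or.inl (by rw [c_of_neg (by simp; omega)]; simp)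
      · refine Or.inr ⟨by dsimp only; rw [mem_triples]; omega, ?_⟩
        simp only [Prod.mk.injEq, true_and]; omega
    · rintro ⟨a, b, g⟩ h
      obtain ⟨g, rfl⟩ : ∃ g', g = g' + 1 :=
        ⟨g - 1, (congrArg (fun p : ℕ × ℕ × ℕ => p.2.2) h).symm⟩
      push_cast
      rw [add_sub_cancel_right]
      congr 1
      ring
  have hr : quasi (t + 1) = ∑ p ∈ triples (t + 1),
      ((-(1 / 3) * (2 * (p.1 : ℚ) + 8 * p.2.1 + 12 * p.2.2 + 1) * c (p.1 - 1) p.2.1 p.2.2) • mon p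
      + (2 / 3 * ((p.1 : ℚ) + 1) * c (p.1 + 1) (p.2.1 - 1) p.2.2) • mon p
      + (8 / 3 * ((p.2.1 : ℚ) + 1) * c p.1 (p.2.1 + 1) (p.2.2 - 1)) • mon p
      + (4 * ((p.2.2 : ℚ) + 1) * c p.1 (p.2.1 - 2) (p.2.2 + 1)) • mon p) := by
    refine Finset.sum_congr rfl ?_
    rintro ⟨a, b, g⟩ h
    rw [mem_triples] at h
    dsimp only
    rw [c_rec a b g (by omega), add_smul, add_smul, add_smul]
  rw [hr, quasi, L_sum]
  simp only [Finset.sum_add_distrib]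
  rw [← e1, ← e2, ← e3, ← e4]
  simp only [← Finset.sum_add_distrib]
  refine Finset.sum_congr rfl ?_
  rintro ⟨a, b, g⟩ -
  rw [L_smul, L_mon]
  simp only [smul_add, smul_smul]

/-- Eight times the heat equation, with 24 U_1 = 1 - E₂ and 4a(a+1) + 1 = (2a+1)^2. -/
theorem U_succ (a : ℕ) :
    (8 * (2 * (a : ℚ) + 3) * (a + 1)) • U (a + 1) = (2 * (a : ℚ) + 1) ^ 2 • U a + L (U a) := by
  have h := D_U a
  have e : (C ((2 * (a : ℚ) + 1) ^ 2) : ℚ⟦X⟧) = 8 * C ((a : ℚ) * (a + 1) / 2) + 1 := by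
    rw [← map_ofNat (C (R := ℚ)), ← map_mul, ← map_one (C (R := ℚ)), ← map_add]
    congr 1
    ring
  rw [smul_eq_C_mul, smul_eq_C_mul, L, e, mul_assoc, map_mul, map_ofNat, E₂_eq, ← U_one]
  linear_combination 8 * h

/-! ### The weights w and the conclusion -/

theorem w_eq (t a : ℕ) : w t a = (a.centralBinom : ℚ) / (16 ^ a * (2 * a + 1)) *
    esum (fun l : ℕ => 1 / (2 * (l : ℚ) + 1) ^ 2) a t := rfl

theorem centralBinom_ratio (a : ℕ) :
    8 * (2 * (a : ℚ) + 3) * (a + 1) *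
      (((a + 1).centralBinom : ℚ) / (16 ^ (a + 1) * (2 * (a + 1 : ℕ) + 1))) =
    (2 * (a : ℚ) + 1) ^ 2 * ((a.centralBinom : ℚ) / (16 ^ a * (2 * a + 1))) := by
  have h : ((a : ℚ) + 1) * (a + 1).centralBinom = 2 * (2 * a + 1) * a.centralBinom := by
    exact_mod_cast Nat.succ_mul_centralBinom_succ a
  push_cast
  have h3 : 2 * ((a : ℚ) + 1) + 1 ≠ 0 := by positivity
  field_simp
  linear_combination (16 * a + 24) * 16 ^ a * h

theorem w_zero_succ (a : ℕ) :
    8 * (2 * (a : ℚ) + 3) * (a + 1) * w 0 (a + 1) = (2 * (a : ℚ) + 1) ^ 2 * w 0 a := by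
  simp only [w_eq, esum_zero_right, mul_one]
  exact centralBinom_ratio a

/-- Splitting off ℓ = a yields 1/(2a+1)^2, which cancels the factor from `centralBinom_ratio`. -/
theorem w_succ_succ (t a : ℕ) :
    8 * (2 * (a : ℚ) + 3) * (a + 1) * w (t + 1) (a + 1) =
      (2 * (a : ℚ) + 1) ^ 2 * w (t + 1) a + w t a := by
  simp only [w_eq, esum_succ_succ]
  rw [← mul_assoc, centralBinom_ratio]
  field_simp

theorem w_eq_zero {t a : ℕ} (h : a < t) : w t a = 0 := by
  rw [w_eq, esum_eq_zero _ h, mul_zero]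

theorem U_eq_sum_quasi (a : ℕ) : U a = ∑ t ∈ Finset.range (a + 1), w t a • quasi t := by
  induction a with
  | zero => simp [U_zero, quasi_zero, w_eq, esum_zero_right]
  | succ a ih =>
    have hK : 8 * (2 * (a : ℚ) + 3) * (a + 1) ≠ 0 := by positivity
    refine smul_right_injective _ hK ?_
    dsimp only
    -- The shifted sum may run to t = a + 1 because `w (a + 1) a = 0`.
    have e : ∑ t ∈ Finset.range (a + 1), w t a • quasi t =
        ∑ t ∈ Finset.range (a + 1), w (t + 1) a • quasi (t + 1) + w 0 a • quasi 0 := by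
      rw [← Finset.sum_range_succ' (fun t => w t a • quasi t), Finset.sum_range_succ _ (a + 1),
        w_eq_zero a.lt_succ_self, zero_smul, add_zero]
    rw [U_succ, Finset.sum_range_succ', smul_add, smul_smul, w_zero_succ, Finset.smul_sum]
    simp only [smul_smul, w_succ_succ, add_smul, Finset.sum_add_distrib]
    conv_lhs => rw [ih]
    rw [L_sum]
    simp only [L_smul, ← quasi_succ]
    rw [e, smul_add, Finset.smul_sum]
    simp only [smul_smul]
    abel

end

end MacMahon

theorem mainTheorem3 (a : ℕ) :
    MacMahon.U a =
      ∑ t ∈ Finset.range (a + 1), MacMahon.w t a •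
        ∑ p ∈ MacMahon.triples t,
          MacMahon.c p.1 p.2.1 p.2.2 •
            (MacMahon.E₂ ^ p.1 * MacMahon.E₄ ^ p.2.1 * MacMahon.E₆ ^ p.2.2) :=
  MacMahon.U_eq_sum_quasi a
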